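/- Let $N\ge 1$ and $d$ be natural numbers, let $\mathcal H_1=\mathbb C^d$, and let $\mathcal H_N=\wedge^N\mathcal H_1$ be the $N$-fermion Hilbert space, i.e. the totally antisymmetric subspace of $\mathcal H_1^{\otimes N}$, of dimension $D$. Let $W$ be a self-adjoint operator on $\mathcal H_N$, and let $w=(w_1,\dots,w_D)$ satisfy $w_1\ge\dots\ge w_D\ge 0$ and $\sum_j w_j=1$. Let $\mathcal E^N$ be the set of density operators on $\mathcal H_N$ (positive semidefinite, trace one). For $v\in\mathbb R^D$ put $\mathcal E^N(v)=\{\Gamma\in\mathcal E^N : \mathrm{spec}^{\downarrow}(\Gamma)=v\}$, where $\mathrm{spec}^{\downarrow}(\Gamma)$ is the decreasingly ordered vector of eigenvalues of $\Gamma$, and $\mathcal E^1_N(v)=N\,\mathrm{Tr}_{N-1}[\mathcal E^N(v)]$, where $\mathrm{Tr}_{N-1}$ is the partial trace over all particles but one. Write $\Gamma\mapsto\gamma$ if $N\,\mathrm{Tr}_{N-1}[\Gamma]=\gamma$. For $u,v\in\mathbb R^D$ write $u\prec v$ if $u^{\downarrow}_1+\dots+u^{\downarrow}_k\le v^{\downarrow}_1+\dots+v^{\downarrow}_k$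 for $k=1,\dots,D$ and $\sum_j u_j=\sum_j v_j$, where $u^\downarrow$ is $u$ with its entries sorted in descending order. For $\gamma\in\mathcal E^1_N(w)$ let $$\mathcal F_w(\gamma)=\min\{\mathrm{Tr}[\Gamma W] : \Gamma\in\mathcal E^N(w),\ \Gamma\mapsto\gamma\}$$ (this minimum is attained). Let $\overline{\mathcal F}_w=\mathrm{conv}(\mathcal F_w)$ be its lower convex envelope on $\mathrm{conv}(\mathcal E^1_N(w))$, i.e. the largest convex function on $\mathrm{conv}(\mathcal E^1_N(w))$ which is at most $\mathcal F_w$ on $\mathcal E^1_N(w)$. Then for every $\gamma\in\mathrm{conv}(\mathcal E^1_N(w))$ $$\overline{\mathcal F}_w(\gamma)=\min\{\mathrm{Tr}[\Gamma W] : \Gamma\in\mathrm{conv}(\mathcal E^N(w)),\ \Gamma\mapsto\gamma\},$$ where the minimum is attained. Moreover $$\mathrm{conv}(\mathcal E^N(w))=\bigcup_{w'\prec w}\mathcal E^N(w')=\{\Gamma\in\mathcal E^N : \mathrm{spec}^{\downarrow}(\Gamma)\prec w\},$$ $$\mathrm{conv}(\mathcal E^1_N(w))=N\,\mathrm{Tr}_{N-1}[\mathrm{conv}(\mathcal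 E^N(w))]=\bigcup_{w'\prec w}\mathcal E^1_N(w').$$ -/

import Mathlib

/-- The vector with the same entries as `v`, sorted in descending order. -/
noncomputable def descending {D : ℕ} (v : Fin D → ℝ) : Fin D → ℝ :=
  v ∘ Tuple.sort (fun i => OrderDual.toDual (v i))

/-- `v ≺ w`: the vector `v` is majorized by the vector `w`. -/
def MajorizedBy {D : ℕ} (v w : Fin D → ℝ) : Prop :=
  (∀ k : Fin D, ∑ i ∈ Finset.Iic k, descending v i ≤ ∑ i ∈ Finset.Iic k, descending w i) ∧
    ∑ i, v i = ∑ i, w i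

/-- The lower convex envelope of a function `f` given on a set `S`: the largest convex function
on the convex hull of `S` that lies below `f` on `S`, evaluated at the point `x`. -/
noncomputable def lowerConvexEnvelope {E : Type*} [AddCommGroup E] [Module ℝ E]
    (S : Set E) (f : E → ℝ) (x : E) : ℝ :=
  sSup {t : ℝ | ∃ g : E → ℝ,
    ConvexOn ℝ (convexHull ℝ S) g ∧ (∀ y ∈ S, g y ≤ f y) ∧ g x = t}

/-- The `N`-fold tensor power of the one-particle Hilbert space `ℂ^d`, as the space of functions
of `N` indices; the tensor product of basis vectors `e_{x 0} ⊗ ⋯ ⊗ e_{x (N-1)}` is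
the coordinate vector of `x`. -/
abbrev ParticleTensor (N d : ℕ) : Type := EuclideanSpace ℂ (Fin N → Fin d)

/-- The totally antisymmetric subspace of the tensor power. -/
def antisymmetricSubspace (N d : ℕ) : Submodule ℂ (ParticleTensor N d) where
  carrier := {ψ | ∀ (σ : Equiv.Perm (Fin N)) (x : Fin N → Fin d),
    ψ (x ∘ σ) = ((Equiv.Perm.sign σ : ℤ) : ℂ) * ψ x}
  add_mem' := by
    intro a b ha hb σ x
    simp only [PiLp.add_apply, ha σ x, hb σ x, mul_add]
  zero_mem' := by
    intro σ x
    simp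
  smul_mem' := by
    intro c a ha σ x
    simp only [PiLp.smul_apply, ha σ x, smul_eq_mul]
    ring

/-- The `N`-fermion Hilbert space `⋀^N ℂ^d`, with the inner product of the tensor power. -/
abbrev FermionSpace (N d : ℕ) : Type := antisymmetricSubspace N d

/-- The dimension `D` of the `N`-fermion Hilbert space. -/
noncomputable abbrev fermionDim (N d : ℕ) : ℕ := Module.finrank ℂ (FermionSpace N d)

/-- The `N`-fermion density operators. -/
def densityOperators (N d : ℕ) : Set (FermionSpace N d →ₗ[ℂ] FermionSpace N d) :=
  {Γ | LinearMap.IsPositive (𝕜 := ℂ) (E := FermionSpace N d) Γ ∧ LinearMap.trace ℂ (FermionSpace N d) Γ = 1}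

open scoped Classical in
/-- The eigenvalues of a self-adjoint operator, repeated according to multiplicity, in descending
order (the value `0` for other operators is never used). -/
noncomputable def specDown {N d : ℕ} (Γ : FermionSpace N d →ₗ[ℂ] FermionSpace N d) :
    Fin (fermionDim N d) → ℝ :=
  if h : LinearMap.IsSymmetric (𝕜 := ℂ) (E := FermionSpace N d) Γ then h.eigenvalues rfl else 0

/-- The `N`-fermion density operators whose decreasingly ordered spectrum is `w`. -/
def ensembleSet (N d : ℕ) (w : Fin (fermionDim N d) → ℝ) :
    Set (FermionSpace N d →ₗ[ℂ] FermionSpace N d) :=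
  {Γ | Γ ∈ densityOperators N d ∧ specDown Γ = w}

/-- The matrix of an operator on the `N`-fermion space, regarded as an operator on the whole tensor
power that vanishes on the orthogonal complement of the antisymmetric subspace. -/
noncomputable def tensorMatrix {N d : ℕ} (Γ : FermionSpace N d →ₗ[ℂ] FermionSpace N d) :
    Matrix (Fin N → Fin d) (Fin N → Fin d) ℂ :=
  Matrix.of fun x y =>
    (Γ ((antisymmetricSubspace N d).orthogonalProjectionOnto
      (EuclideanSpace.single y (1 : ℂ))) : ParticleTensor N d) x

/-- The partial trace `Tr_{N-1}` over all particles except the first one. An index tuple is split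
into its first entry `i` and the tuple `y` of its other entries. -/
noncomputable def partialTrace {N d : ℕ} [NeZero N]
    (A : Matrix (Fin N → Fin d) (Fin N → Fin d) ℂ) : Matrix (Fin d) (Fin d) ℂ :=
  Matrix.of fun i j => ∑ y : {k : Fin N // k ≠ 0} → Fin d,
    A ((Equiv.funSplitAt (0 : Fin N) (Fin d)).symm (i, y))
      ((Equiv.funSplitAt (0 : Fin N) (Fin d)).symm (j, y))

/-- The one-particle reduced density matrix `N Tr_{N-1}[Γ]`. -/
noncomputable def oneRDM {N d : ℕ} [NeZero N] (Γ : FermionSpace N d →ₗ[ℂ] FermionSpace N d) :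
    Matrix (Fin d) (Fin d) ℂ :=
  (N : ℂ) • partialTrace (tensorMatrix Γ)

/-- The `w`-ensemble `N`-representable one-particle reduced density matrices. -/
def oneRDMSet (N d : ℕ) [NeZero N] (w : Fin (fermionDim N d) → ℝ) :
    Set (Matrix (Fin d) (Fin d) ℂ) :=
  oneRDM '' ensembleSet N d w

/-- The expectation value `Tr[Γ W]`, which is real for self-adjoint `Γ` and `W`. -/
noncomputable def expectation {N d : ℕ} (W Γ : FermionSpace N d →ₗ[ℂ] FermionSpace N d) : ℝ :=
  (LinearMap.trace ℂ (FermionSpace N d) (Γ ∘ₗ W)).re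

/-- The values `Tr[Γ W]` of all `Γ` in the set `A` with one-particle reduced density matrix `γ`. -/
def searchValues {N d : ℕ} [NeZero N] (W : FermionSpace N d →ₗ[ℂ] FermionSpace N d)
    (A : Set (FermionSpace N d →ₗ[ℂ] FermionSpace N d)) (γ : Matrix (Fin d) (Fin d) ℂ) : Set ℝ :=
  {t | ∃ Γ ∈ A, oneRDM Γ = γ ∧ expectation W Γ = t}

/-- The `w`-ensemble functional on `oneRDMSet N d w`, given by the constrained search over density
operators with spectrum `w`. -/
noncomputable def ensembleFunctional {N d : ℕ} [NeZero N]
    (W : FermionSpace N d →ₗ[ℂ] FermionSpace N d) (w : Fin (fermionDim N d) → ℝ)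
    (γ : Matrix (Fin d) (Fin d) ℂ) : ℝ :=
  sInf (searchValues W (ensembleSet N d w) γ)

/-- The relaxed `w`-ensemble functional on the convex hull of `oneRDMSet N d w`: the lower convex
envelope of the `w`-ensemble functional. -/
noncomputable def relaxedFunctional {N d : ℕ} [NeZero N]
    (W : FermionSpace N d →ₗ[ℂ] FermionSpace N d) (w : Fin (fermionDim N d) → ℝ)
    (γ : Matrix (Fin d) (Fin d) ℂ) : ℝ :=
  lowerConvexEnvelope (oneRDMSet N d w) (ensembleFunctional W w) γ

theorem descending_eq_self {n : ℕ} {v : Fin n → ℝ} (hv : Antitone v) : descending v = v := by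
  have h : Tuple.sort (fun i => OrderDual.toDual (v i)) = Equiv.refl _ :=
    Tuple.sort_eq_refl_iff_monotone.2 fun i j hij => hv hij
  funext i
  simp [descending, h]

/-- A weighted sum with weights in `[0, 1]` of total weight `k + 1` is at most the sum of the
`k + 1` largest entries. -/
theorem sum_mul_le_sum_Iic {n : ℕ} {w c : Fin n → ℝ} (hw : Antitone w) (k : Fin n)
    (hc0 : ∀ i, 0 ≤ c i) (hc1 : ∀ i, c i ≤ 1) (hc : ∑ i, c i = (Finset.Iic k).card) :
    ∑ i, c i * w i ≤ ∑ i ∈ Finset.Iic k, w i := by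
  have hind : ∀ f : Fin n → ℝ, ∑ i ∈ Finset.Iic k, f i = ∑ i, (if i ≤ k then 1 else 0) * f i := by
    intro f
    rw [← Finset.sum_subset (Finset.subset_univ (Finset.Iic k))]
    · exact Finset.sum_congr rfl fun i hi => by simp [Finset.mem_Iic.1 hi]
    · intro i _ hi
      simp [show ¬ i ≤ k by simpa using hi]
  have hcard : ((Finset.Iic k).card : ℝ) = ∑ i : Fin n, (if i ≤ k then 1 else 0) := by
    have := hind fun _ => 1
    simpa only [Finset.sum_const, nsmul_eq_mul, mul_one] using this
  have hterm : ∀ i, (c i - if i ≤ k then 1 else 0) * (w i - w k) ≤ 0 := by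
    intro i
    split_ifs with h
    · exact mul_nonpos_of_nonpos_of_nonneg (by linarith [hc1 i]) (by linarith [hw h])
    · exact mul_nonpos_of_nonneg_of_nonpos (by linarith [hc0 i])
        (by linarith [hw (le_of_not_ge h)])
  have hsum := Finset.sum_nonpos fun i (_ : i ∈ Finset.univ) => hterm i
  have hexp : ∑ i, (c i - if i ≤ k then 1 else 0) * (w i - w k) =
      (∑ i, c i * w i - ∑ i, (if i ≤ k then 1 else 0) * w i) -
        (∑ i, c i - ∑ i : Fin n, (if i ≤ k then 1 else 0)) * w k := by
    rw [← Finset.sum_sub_distrib, ← Finset.sum_sub_distrib, Finset.sum_mul,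
      ← Finset.sum_sub_distrib]
    exact Finset.sum_congr rfl fun i _ => by ring
  rw [hexp, hc, hcard, sub_self, zero_mul, sub_zero, ← hind] at hsum
  linarith

theorem last_mul_sum_le_sum_mul {n : ℕ} {c x : Fin (n + 1) → ℝ} (hc : Antitone c)
    (hx : ∀ k, 0 ≤ ∑ i ∈ Finset.Iic k, x i) : c (Fin.last n) * ∑ i, x i ≤ ∑ i, c i * x i := by
  induction n with
  | zero => simp
  | succ n ih =>
    have hIic : ∀ k : Fin (n + 1),
        ∑ i ∈ Finset.Iic k.castSucc, x i = ∑ i ∈ Finset.Iic k, x i.castSucc := by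
      intro k
      rw [← Fin.map_castSuccEmb_Iic, Finset.sum_map]
      rfl
    have h := ih (c := c ∘ Fin.castSucc) (x := x ∘ Fin.castSucc)
      (fun i j hij => hc (by simpa using hij)) fun k => by
        simpa [hIic] using hx k.castSucc
    have hnn : 0 ≤ ∑ i : Fin (n + 1), x i.castSucc := by
      have := hx (Fin.last n).castSucc
      rw [hIic, show Finset.Iic (Fin.last n) = Finset.univ from Finset.Iic_top] at this
      exact this
    have hle : c (Fin.last (n + 1)) ≤ c (Fin.last n).castSucc := hc (Fin.le_last _)
    rw [Fin.sum_univ_castSucc, Fin.sum_univ_castSucc (fun i => c i * x i)]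
    simp only [Function.comp_apply] at h
    nlinarith [mul_le_mul_of_nonneg_right hle hnn]

/-- Abel summation: an antitone weight respects the majorization order. -/
theorem sum_mul_le_sum_mul_of_partial_sums_le {n : ℕ} {c v w : Fin n → ℝ} (hc : Antitone c)
    (h : ∀ k, ∑ i ∈ Finset.Iic k, v i ≤ ∑ i ∈ Finset.Iic k, w i) (hs : ∑ i, v i = ∑ i, w i) :
    ∑ i, c i * v i ≤ ∑ i, c i * w i := by
  cases n with
  | zero => simp
  | succ n =>
    have := last_mul_sum_le_sum_mul (x := w - v) hc fun k => by
      simpa [Finset.sum_sub_distrib] using h k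
    simp only [Pi.sub_apply, mul_sub, Finset.sum_sub_distrib, hs, sub_self] at this
    linarith

/-- Rado's theorem: a vector majorized by `w` is a convex combination of permutations of `w`. -/
theorem mem_convexHull_perm_of_majorizedBy {n : ℕ} {v w : Fin n → ℝ} (hv : Antitone v)
    (hw : Antitone w) (h : MajorizedBy v w) :
    v ∈ convexHull ℝ (Set.range fun σ : Equiv.Perm (Fin n) => w ∘ σ) := by
  by_contra hnot
  obtain ⟨f, r, hfr, hrv⟩ := geometric_hahn_banach_closed_point (convex_convexHull ℝ _)
    ((Set.finite_range fun σ : Equiv.Perm (Fin n) => w ∘ σ).isClosed_convexHull ℝ) hnot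
  set c : Fin n → ℝ := fun i => f (Pi.single i 1)
  have hf : ∀ x, f x = ∑ i, c i * x i := by
    intro x
    conv_lhs => rw [← Finset.univ_sum_single x, map_sum]
    refine Finset.sum_congr rfl fun i _ => ?_
    rw [show Pi.single i (x i) = x i • (Pi.single i 1 : Fin n → ℝ) by
      rw [← Pi.single_smul, smul_eq_mul, mul_one], map_smul, smul_eq_mul, mul_comm]
  set τ := Tuple.sort fun i => OrderDual.toDual (c i)
  have hτ : Antitone (c ∘ τ) := fun i j hij => Tuple.monotone_sort (fun i => OrderDual.toDual (c i)) hij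
  have h1 : f v ≤ ∑ i, (c ∘ τ) i * v i := by
    have := (hτ.monovary hv).sum_comp_perm_mul_le_sum_mul (σ := τ⁻¹)
    rw [hf]
    simpa using this
  have h2 : ∑ i, (c ∘ τ) i * v i ≤ ∑ i, (c ∘ τ) i * w i := by
    refine sum_mul_le_sum_mul_of_partial_sums_le hτ (fun k => ?_) h.2
    simpa only [descending_eq_self hv, descending_eq_self hw] using h.1 k
  have h3 : ∑ i, (c ∘ τ) i * w i = f (w ∘ τ.symm) := by
    rw [hf, ← Equiv.sum_comp τ fun i => c i * (w ∘ τ.symm) i]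
    simp
  have h4 := hfr _ (subset_convexHull ℝ _ ⟨τ.symm, rfl⟩)
  linarith

section Spectral

variable {H : Type*} [NormedAddCommGroup H] [InnerProductSpace ℂ H]

/-- The operator `∑ k, v k |u k⟩⟨u k|`. -/
noncomputable def spectralSum {n : ℕ} (u : Fin n → H) (v : Fin n → ℝ) : H →L[ℂ] H :=
  ∑ k, (v k : ℂ) • InnerProductSpace.rankOne ℂ (u k) (u k)

theorem spectralSum_apply {n : ℕ} (u : Fin n → H) (v : Fin n → ℝ) (x : H) :
    spectralSum u v x = ∑ k, (v k : ℂ) • inner ℂ (u k) x • u k := by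
  simp [spectralSum]

theorem spectralSum_apply_basis {n : ℕ} (b : OrthonormalBasis (Fin n) ℂ H) (v : Fin n → ℝ)
    (j : Fin n) : spectralSum b v (b j) = (v j : ℂ) • b j := by
  rw [spectralSum_apply, Finset.sum_eq_single j]
  · simp
  · intro k _ hk
    rw [b.inner_eq_zero hk, zero_smul, smul_zero]
  · simp

theorem spectralSum_comp_perm {n : ℕ} (u : Fin n → H) (v : Fin n → ℝ)
    (σ : Equiv.Perm (Fin n)) : spectralSum (u ∘ σ) (v ∘ σ) = spectralSum u v :=
  Equiv.sum_comp σ fun k => (v k : ℂ) • InnerProductSpace.rankOne ℂ (u k) (u k)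

theorem isPositive_spectralSum {n : ℕ} (u : Fin n → H) {v : Fin n → ℝ} (hv : ∀ k, 0 ≤ v k) :
    (spectralSum u v : H →ₗ[ℂ] H).IsPositive := by
  have : (spectralSum u v).IsPositive := by
    unfold spectralSum
    refine Finset.sum_induction _ _ (fun _ _ => ContinuousLinearMap.IsPositive.add)
      ContinuousLinearMap.isPositive_zero fun k _ => ?_
    exact (InnerProductSpace.isPositive_rankOne_self (u k)).smul_of_nonneg (by exact_mod_cast hv k)
  exact this

theorem re_inner_spectralSum {n : ℕ} (u : Fin n → H) (v : Fin n → ℝ) (x : H) :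
    (inner ℂ x (spectralSum u v x)).re = ∑ k, ‖inner ℂ (u k) x‖ ^ 2 * v k := by
  rw [spectralSum_apply, inner_sum, Complex.re_sum]
  refine Finset.sum_congr rfl fun k _ => ?_
  rw [inner_smul_right, inner_smul_right, ← inner_conj_symm x (u k), Complex.mul_conj,
    ← Complex.ofReal_mul, Complex.ofReal_re, Complex.normSq_eq_norm_sq, mul_comm]

theorem trace_spectralSum {n : ℕ} (b : OrthonormalBasis (Fin n) ℂ H) (v : Fin n → ℝ) :
    LinearMap.trace ℂ H (spectralSum b v) = ((∑ k, v k : ℝ) : ℂ) := by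
  rw [LinearMap.trace_eq_sum_inner _ b]
  simp [spectralSum_apply_basis, inner_smul_right, -Complex.coe_smul]

theorem eq_spectralSum_of_isSymmetric [FiniteDimensional ℂ H] {n : ℕ}
    (hn : Module.finrank ℂ H = n) {T : H →ₗ[ℂ] H} (hT : T.IsSymmetric) :
    T = spectralSum (hT.eigenvectorBasis hn) (hT.eigenvalues hn) := by
  refine (hT.eigenvectorBasis hn).toBasis.ext fun j => ?_
  simp [spectralSum_apply_basis]

theorem eigenvalues_spectralSum [FiniteDimensional ℂ H] {n : ℕ} (hn : Module.finrank ℂ H = n)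
    (b : OrthonormalBasis (Fin n) ℂ H) {v : Fin n → ℝ} (hv : Antitone v)
    (hT : (spectralSum b v : H →ₗ[ℂ] H).IsSymmetric) : hT.eigenvalues hn = v := by
  have hmat : LinearMap.toMatrix b.toBasis b.toBasis (spectralSum b v : H →ₗ[ℂ] H) =
      Matrix.diagonal fun k => (v k : ℂ) := by
    ext i j
    by_cases h : i = j
    · subst h
      simp [LinearMap.toMatrix_apply, spectralSum_apply_basis, -Complex.coe_smul]
    · simp [LinearMap.toMatrix_apply, spectralSum_apply_basis, h, -Complex.coe_smul]
  have hroots : (spectralSum b v : H →ₗ[ℂ] H).charpoly.roots =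
      Multiset.map (fun k => (v k : ℂ)) Finset.univ.val := by
    rw [← LinearMap.charpoly_toMatrix _ b.toBasis, hmat, Matrix.charpoly_diagonal,
      Polynomial.roots_prod _ _ (by
        simp [Finset.prod_ne_zero_iff, Polynomial.X_sub_C_ne_zero])]
    simp
  rw [hT.roots_charpoly_eq_eigenvalues hn] at hroots
  have hperm := congrArg (Multiset.map Complex.re) hroots
  simp only [Fin.univ_val_map, Multiset.map_coe, List.map_ofFn, Multiset.coe_eq_coe] at hperm
  refine List.ofFn_injective (List.Perm.eq_of_pairwise' (r := (· ≥ ·)) ?_ ?_ hperm)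
  · exact (hT.eigenvalues_antitone hn).sortedGE_ofFn.pairwise
  · exact hv.sortedGE_ofFn.pairwise

/-- Ky Fan's inequality for a spectral sum. -/
theorem sum_re_inner_spectralSum_le {n : ℕ} (b b' : OrthonormalBasis (Fin n) ℂ H)
    {w : Fin n → ℝ} (hw : Antitone w) (k : Fin n) :
    ∑ j ∈ Finset.Iic k, (inner ℂ (b' j) (spectralSum b w (b' j))).re ≤
      ∑ j ∈ Finset.Iic k, w j := by
  simp only [re_inner_spectralSum]
  rw [Finset.sum_comm]
  simp only [← Finset.sum_mul]
  refine sum_mul_le_sum_Iic hw k (fun i => by positivity) (fun i => ?_) ?_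
  · calc ∑ j ∈ Finset.Iic k, ‖inner ℂ (b i) (b' j)‖ ^ 2
        ≤ ∑ j, ‖inner ℂ (b i) (b' j)‖ ^ 2 :=
          Finset.sum_le_sum_of_subset_of_nonneg (Finset.subset_univ _) fun _ _ _ => by positivity
      _ = 1 := by rw [b'.sum_sq_norm_inner_left]; simp
  · rw [Finset.sum_comm]
    simp [b.sum_sq_norm_inner_right]

theorem isCompact_setOf_orthonormal [FiniteDimensional ℂ H] (n : ℕ) :
    IsCompact {u : Fin n → H | Orthonormal ℂ u} := by
  have : ProperSpace H := FiniteDimensional.proper ℂ H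
  refine Metric.isCompact_of_isClosed_isBounded ?_ ?_
  · simp only [orthonormal_iff_ite, Set.ofPred_forall]
    exact isClosed_iInter fun i => isClosed_iInter fun j =>
      isClosed_eq (by fun_prop) continuous_const
  · refine (Metric.isBounded_closedBall (x := (0 : Fin n → H)) (r := 1)).subset fun u hu => ?_
    rw [mem_closedBall_zero_iff, pi_norm_le_iff_of_nonneg zero_le_one]
    exact fun i => (hu.1 i).le

theorem continuous_spectralSum (n : ℕ) :
    Continuous fun p : (Fin n → H) × (Fin n → ℝ) => spectralSum p.1 p.2 := by
  unfold spectralSum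
  simp only [InnerProductSpace.rankOne_def]
  fun_prop

theorem Orthonormal.exists_orthonormalBasis [FiniteDimensional ℂ H] {n : ℕ}
    (hn : Module.finrank ℂ H = n) {u : Fin n → H} (hu : Orthonormal ℂ u) :
    ∃ b : OrthonormalBasis (Fin n) ℂ H, ⇑b = u := by
  refine ⟨OrthonormalBasis.mk hu ?_, OrthonormalBasis.coe_mk hu _⟩
  rw [hu.linearIndependent.span_eq_top_of_card_eq_finrank' (by simp [hn])]

/-- A real-linear function of a spectral sum depends continuously on its vectors and weights. -/
theorem continuous_realLinear_spectralSum [FiniteDimensional ℂ H] {M : Type*} [AddCommGroup M]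
    [Module ℝ M] [TopologicalSpace M] [IsTopologicalAddGroup M] [ContinuousSMul ℝ M]
    (φ : (H →ₗ[ℂ] H) → M) (hadd : ∀ S T, φ (S + T) = φ S + φ T)
    (hsmul : ∀ (s : ℝ) T, φ ((s : ℂ) • T) = s • φ T) (n : ℕ) :
    Continuous fun p : (Fin n → H) × (Fin n → ℝ) => φ (spectralSum p.1 p.2) := by
  let ψ : (H →L[ℂ] H) →ₗ[ℝ] M :=
    { toFun := fun T => φ T
      map_add' := fun S T => hadd S T
      map_smul' := fun s T => hsmul s T }
  have : FiniteDimensional ℝ (H →L[ℂ] H) := Module.Finite.trans ℂ _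
  exact ψ.continuous_of_finiteDimensional.comp (continuous_spectralSum n)

open scoped Classical in
/-- The eigenvalues of a symmetric operator in descending order; `0` for other operators. -/
noncomputable def descendingSpectrum [FiniteDimensional ℂ H] {n : ℕ}
    (hn : Module.finrank ℂ H = n) (T : H →ₗ[ℂ] H) : Fin n → ℝ :=
  if h : T.IsSymmetric then h.eigenvalues hn else 0

variable (H) in
/-- The positive operators of trace one. -/
def unitTracePositive : Set (H →ₗ[ℂ] H) :=
  {T | T.IsPositive ∧ LinearMap.trace ℂ H T = 1}

/-- The positive operators of trace one with descending spectrum `w`. -/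
def isospectralStates [FiniteDimensional ℂ H] {n : ℕ} (hn : Module.finrank ℂ H = n)
    (w : Fin n → ℝ) : Set (H →ₗ[ℂ] H) :=
  {T | T ∈ unitTracePositive H ∧ descendingSpectrum hn T = w}

variable (H) in
/-- The operators `∑ k, v k |u k⟩⟨u k|` with `u` orthonormal and `v` in `K`. -/
def spectralSumSet {n : ℕ} (K : Set (Fin n → ℝ)) : Set (H →ₗ[ℂ] H) :=
  (fun p : (Fin n → H) × (Fin n → ℝ) => (spectralSum p.1 p.2 : H →ₗ[ℂ] H)) ''
    ({u | Orthonormal ℂ u} ×ˢ K)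

theorem re_inner_apply_of_eq_spectralSum {n : ℕ} (b : OrthonormalBasis (Fin n) ℂ H)
    {T : H →ₗ[ℂ] H} {v : Fin n → ℝ} (hT : T = spectralSum b v) (j : Fin n) :
    (inner ℂ (b j) (T (b j))).re = v j := by
  have hj : T (b j) = (v j : ℂ) • b j := hT ▸ spectralSum_apply_basis b v j
  rw [hj, inner_smul_right, inner_self_eq_norm_sq_to_K, b.norm_eq_one]
  simp

section ConvexSets

variable [Module ℝ H] [IsScalarTower ℝ ℂ H] [SMulCommClass ℂ ℝ H]

theorem LinearMap.real_smul_eq_complex_smul (s : ℝ) (T : H →ₗ[ℂ] H) : s • T = (s : ℂ) • T := by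
  ext x
  exact (algebraMap_smul ℂ s (T x)).symm

theorem convex_unitTracePositive : Convex ℝ (unitTracePositive H) := by
  intro S hS T hT s t hs ht hst
  rw [LinearMap.real_smul_eq_complex_smul, LinearMap.real_smul_eq_complex_smul]
  refine ⟨?_, ?_⟩
  · exact (hS.1.smul_of_nonneg (by exact_mod_cast hs)).add
      (hT.1.smul_of_nonneg (by exact_mod_cast ht))
  · rw [map_add, map_smul, map_smul, hS.2, hT.2]
    simp only [smul_eq_mul, mul_one]
    exact_mod_cast hst

theorem convex_setOf_kyFan {n : ℕ} (w : Fin n → ℝ) :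
    Convex ℝ {T : H →ₗ[ℂ] H | ∀ (b : OrthonormalBasis (Fin n) ℂ H) (k : Fin n),
      ∑ j ∈ Finset.Iic k, (inner ℂ (b j) (T (b j))).re ≤ ∑ j ∈ Finset.Iic k, w j} := by
  intro S hS T hT s t hs ht hst b k
  have h : ∀ j, (inner ℂ (b j) ((s • S + t • T) (b j))).re =
      s * (inner ℂ (b j) (S (b j))).re + t * (inner ℂ (b j) (T (b j))).re := by
    intro j
    rw [LinearMap.real_smul_eq_complex_smul, LinearMap.real_smul_eq_complex_smul]
    simp only [LinearMap.add_apply, LinearMap.smul_apply, inner_add_right, inner_smul_right,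
      Complex.add_re, Complex.re_ofReal_mul]
  simp only [h, Finset.sum_add_distrib, ← Finset.mul_sum]
  calc _ ≤ s * ∑ j ∈ Finset.Iic k, w j + t * ∑ j ∈ Finset.Iic k, w j :=
        add_le_add (mul_le_mul_of_nonneg_left (hS b k) hs) (mul_le_mul_of_nonneg_left (hT b k) ht)
    _ = ∑ j ∈ Finset.Iic k, w j := by rw [← add_mul, hst, one_mul]

end ConvexSets

variable [FiniteDimensional ℂ H] {n : ℕ} (hn : Module.finrank ℂ H = n)

theorem descendingSpectrum_spectralSum (b : OrthonormalBasis (Fin n) ℂ H) {v : Fin n → ℝ}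
    (hv : Antitone v) (hv0 : ∀ k, 0 ≤ v k) :
    descendingSpectrum hn (spectralSum b v : H →ₗ[ℂ] H) = v := by
  have h := (isPositive_spectralSum b hv0).isSymmetric
  rw [descendingSpectrum, dif_pos h]
  exact eigenvalues_spectralSum hn b hv h

theorem exists_eq_spectralSum {T : H →ₗ[ℂ] H} (hT : T ∈ unitTracePositive H) :
    ∃ b : OrthonormalBasis (Fin n) ℂ H, T = spectralSum b (descendingSpectrum hn T) := by
  have h := hT.1.isSymmetric
  refine ⟨h.eigenvectorBasis hn, ?_⟩
  rw [descendingSpectrum, dif_pos h]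
  exact eq_spectralSum_of_isSymmetric hn h

theorem antitone_descendingSpectrum {T : H →ₗ[ℂ] H} (hT : T ∈ unitTracePositive H) :
    Antitone (descendingSpectrum hn T) := by
  rw [descendingSpectrum, dif_pos hT.1.isSymmetric]
  exact hT.1.isSymmetric.eigenvalues_antitone hn

theorem sum_descendingSpectrum {T : H →ₗ[ℂ] H} (hT : T ∈ unitTracePositive H) :
    ∑ k, descendingSpectrum hn T k = 1 := by
  obtain ⟨b, hb⟩ := exists_eq_spectralSum hn hT
  have h := (trace_spectralSum b _).symm.trans ((congrArg _ hb.symm).trans hT.2)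
  exact_mod_cast h

variable {w : Fin n → ℝ}

theorem spectralSum_mem_isospectralStates (hw : Antitone w) (hw0 : ∀ k, 0 ≤ w k)
    (hw1 : ∑ k, w k = 1) (b : OrthonormalBasis (Fin n) ℂ H) :
    (spectralSum b w : H →ₗ[ℂ] H) ∈ isospectralStates hn w :=
  ⟨⟨isPositive_spectralSum b hw0, by rw [trace_spectralSum, hw1, Complex.ofReal_one]⟩,
    descendingSpectrum_spectralSum hn b hw hw0⟩

theorem isospectralStates_eq_spectralSumSet (hw : Antitone w) (hw0 : ∀ k, 0 ≤ w k)
    (hw1 : ∑ k, w k = 1) : isospectralStates hn w = spectralSumSet H {w} := by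
  apply Set.Subset.antisymm
  · rintro T ⟨hT, rfl⟩
    obtain ⟨b, hb⟩ := exists_eq_spectralSum hn hT
    exact ⟨(b, descendingSpectrum hn T), ⟨b.orthonormal, rfl⟩, hb.symm⟩
  · rintro _ ⟨⟨u, v⟩, ⟨hu, hv⟩, rfl⟩
    obtain rfl : v = w := hv
    obtain ⟨b, rfl⟩ := Orthonormal.exists_orthonormalBasis hn hu
    exact spectralSum_mem_isospectralStates hn hw hw0 hw1 b

/-- A constrained search over a compact family of spectral sums attains its minimum. -/
theorem isLeast_constrained_spectralSumSet {M : Type*} [AddCommGroup M]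
    [Module ℝ M] [TopologicalSpace M] [IsTopologicalAddGroup M] [ContinuousSMul ℝ M] [T2Space M]
    {φ : (H →ₗ[ℂ] H) → ℝ} (φ_add : ∀ S T, φ (S + T) = φ S + φ T)
    (φ_smul : ∀ (s : ℝ) T, φ ((s : ℂ) • T) = s • φ T)
    {ψ : (H →ₗ[ℂ] H) → M} (ψ_add : ∀ S T, ψ (S + T) = ψ S + ψ T)
    (ψ_smul : ∀ (s : ℝ) T, ψ ((s : ℂ) • T) = s • ψ T)
    {K : Set (Fin n → ℝ)} (hK : IsCompact K) {y : M} (hy : y ∈ ψ '' spectralSumSet H K) :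
    IsLeast {t | ∃ T ∈ spectralSumSet H K, ψ T = y ∧ φ T = t}
      (sInf {t | ∃ T ∈ spectralSumSet H K, ψ T = y ∧ φ T = t}) := by
  obtain ⟨T₀, hT₀, hy₀⟩ := hy
  refine IsCompact.isLeast_sInf ?_ ⟨_, T₀, hT₀, hy₀, rfl⟩
  have hclosed : IsClosed {p : (Fin n → H) × (Fin n → ℝ) | ψ (spectralSum p.1 p.2) = y} :=
    isClosed_eq (continuous_realLinear_spectralSum ψ ψ_add ψ_smul n) continuous_const
  convert (((isCompact_setOf_orthonormal n).prod hK).inter_right hclosed).image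
    (continuous_realLinear_spectralSum φ φ_add φ_smul n) using 1
  ext t
  constructor
  · rintro ⟨_, ⟨p, hp, rfl⟩, hγ, ht⟩
    exact ⟨p, ⟨hp, hγ⟩, ht⟩
  · rintro ⟨p, ⟨hp, hγ⟩, ht⟩
    exact ⟨_, ⟨p, hp, rfl⟩, hγ, ht⟩

theorem isospectralStates_subset_unitTracePositive :
    isospectralStates hn w ⊆ unitTracePositive H := fun _ hT => hT.1

theorem isospectralStates_subset_setOf_kyFan (hw : Antitone w) :
    isospectralStates hn w ⊆
      {T : H →ₗ[ℂ] H | ∀ (b : OrthonormalBasis (Fin n) ℂ H) (k : Fin n),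
        ∑ j ∈ Finset.Iic k, (inner ℂ (b j) (T (b j))).re ≤ ∑ j ∈ Finset.Iic k, w j} := by
  rintro S ⟨hS, rfl⟩ b' k
  obtain ⟨b, hb⟩ := exists_eq_spectralSum hn hS
  have h := sum_re_inner_spectralSum_le b b' hw k
  have hS' : ∀ x, spectralSum b (descendingSpectrum hn S) x = S x := fun x =>
    (LinearMap.congr_fun hb x).symm
  simpa only [hS'] using h

theorem subset_spectralSumSet_convexHull_perm (hw : Antitone w) :
    {T ∈ unitTracePositive H | MajorizedBy (descendingSpectrum hn T) w} ⊆ spectralSumSet H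
      (convexHull ℝ (Set.range fun σ : Equiv.Perm (Fin n) => w ∘ σ)) := by
  rintro T ⟨hT, hmaj⟩
  obtain ⟨b, hb⟩ := exists_eq_spectralSum hn hT
  exact ⟨(b, descendingSpectrum hn T), ⟨b.orthonormal,
    mem_convexHull_perm_of_majorizedBy (antitone_descendingSpectrum hn hT) hw hmaj⟩, hb.symm⟩

section Convex

variable [Module ℝ H] [IsScalarTower ℝ ℂ H] [SMulCommClass ℂ ℝ H]

/-- `spectralSum u v` depends linearly on `v`. -/
noncomputable def spectralSumₗ (u : Fin n → H) : (Fin n → ℝ) →ₗ[ℝ] (H →ₗ[ℂ] H) where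
  toFun v := spectralSum u v
  map_add' v v' := by
    ext x
    simp [spectralSum_apply, add_smul, Finset.sum_add_distrib, -Complex.coe_smul]
  map_smul' c v := by
    rw [LinearMap.real_smul_eq_complex_smul]
    ext x
    simp [spectralSum_apply, mul_smul, Finset.smul_sum, -Complex.coe_smul]

theorem convexHull_isospectralStates_subset (hw : Antitone w) (hw1 : ∑ k, w k = 1) :
    convexHull ℝ (isospectralStates hn w) ⊆
      {T ∈ unitTracePositive H | MajorizedBy (descendingSpectrum hn T) w} := by
  intro T hT
  have hdens : T ∈ unitTracePositive H :=
    convexHull_min (isospectralStates_subset_unitTracePositive hn) convex_unitTracePositive hT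
  have hKF := convexHull_min (isospectralStates_subset_setOf_kyFan hn hw) (convex_setOf_kyFan w) hT
  refine ⟨hdens, fun k => ?_, (sum_descendingSpectrum hn hdens).trans hw1.symm⟩
  obtain ⟨b, hb⟩ := exists_eq_spectralSum hn hdens
  have h := hKF b k
  simp only [re_inner_apply_of_eq_spectralSum b hb] at h
  rwa [descending_eq_self hw, descending_eq_self (antitone_descendingSpectrum hn hdens)]

theorem spectralSumSet_convexHull_perm_subset (hw : Antitone w) (hw0 : ∀ k, 0 ≤ w k)
    (hw1 : ∑ k, w k = 1) :
    spectralSumSet H (convexHull ℝ (Set.range fun σ : Equiv.Perm (Fin n) => w ∘ σ)) ⊆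
      convexHull ℝ (isospectralStates hn w) := by
  rintro _ ⟨⟨u, v⟩, ⟨hu, hv⟩, rfl⟩
  have himg := Set.mem_image_of_mem (spectralSumₗ u) hv
  rw [LinearMap.image_convexHull] at himg
  refine convexHull_mono ?_ himg
  rintro _ ⟨_, ⟨σ, rfl⟩, rfl⟩
  obtain ⟨b, rfl⟩ := Orthonormal.exists_orthonormalBasis hn hu
  have h := spectralSum_mem_isospectralStates hn hw hw0 hw1 (b.reindex σ)
  rw [← spectralSum_comp_perm _ _ σ] at h
  have hb : ⇑(b.reindex σ) ∘ σ = b := by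
    ext1 j
    simp
  rw [hb] at h
  exact h

/-- The convex hull of the states with spectrum `w` consists of the states whose spectrum is
majorized by `w`. -/
theorem convexHull_isospectralStates (hw : Antitone w) (hw0 : ∀ k, 0 ≤ w k)
    (hw1 : ∑ k, w k = 1) : convexHull ℝ (isospectralStates hn w) =
      {T ∈ unitTracePositive H | MajorizedBy (descendingSpectrum hn T) w} :=
  (convexHull_isospectralStates_subset hn hw hw1).antisymm
    ((subset_spectralSumSet_convexHull_perm hn hw).trans
      (spectralSumSet_convexHull_perm_subset hn hw hw0 hw1))

theorem convexHull_isospectralStates_eq_spectralSumSet (hw : Antitone w) (hw0 : ∀ k, 0 ≤ w k)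
    (hw1 : ∑ k, w k = 1) : convexHull ℝ (isospectralStates hn w) =
      spectralSumSet H (convexHull ℝ (Set.range fun σ : Equiv.Perm (Fin n) => w ∘ σ)) :=
  ((convexHull_isospectralStates_subset hn hw hw1).trans
    (subset_spectralSumSet_convexHull_perm hn hw)).antisymm
      (spectralSumSet_convexHull_perm_subset hn hw hw0 hw1)

end Convex

end Spectral

theorem le_of_convexOn_of_le_of_mem_convexHull {V E : Type*} [AddCommGroup V] [Module ℝ V]
    [AddCommGroup E] [Module ℝ E] (A : Set V) (ψ : V →ₗ[ℝ] E) (φ : V →ₗ[ℝ] ℝ) {g : E → ℝ}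
    (hg : ConvexOn ℝ (convexHull ℝ (ψ '' A)) g) (hle : ∀ a ∈ A, g (ψ a) ≤ φ a) {a : V}
    (ha : a ∈ convexHull ℝ A) : g (ψ a) ≤ φ a := by
  have hconv : Convex ℝ {a | a ∈ ψ ⁻¹' convexHull ℝ (ψ '' A) ∧ ((g ∘ ψ) - φ) a ≤ 0} :=
    ((hg.comp_linearMap ψ).sub (φ.concaveOn ((convex_convexHull ℝ _).linear_preimage ψ))).convex_le 0
  have hsub : A ⊆ {a | a ∈ ψ ⁻¹' convexHull ℝ (ψ '' A) ∧ ((g ∘ ψ) - φ) a ≤ 0} := fun a ha =>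
    ⟨subset_convexHull ℝ _ ⟨a, ha, rfl⟩, by simpa using hle a ha⟩
  simpa using (convexHull_min hsub hconv ha).2

/-- The lower convex envelope of a constrained minimum of a linear function over a set is
the constrained minimum over its convex hull, provided the latter is attained. -/
theorem lowerConvexEnvelope_eq_sInf {V E : Type*} [AddCommGroup V] [Module ℝ V]
    [AddCommGroup E] [Module ℝ E] (A : Set V) (ψ : V →ₗ[ℝ] E) (φ : V →ₗ[ℝ] ℝ)
    (hA : ∀ y ∈ ψ '' A, IsLeast {t | ∃ a ∈ A, ψ a = y ∧ φ a = t}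
      (sInf {t | ∃ a ∈ A, ψ a = y ∧ φ a = t}))
    (hconv : ∀ y ∈ convexHull ℝ (ψ '' A), IsLeast {t | ∃ a ∈ convexHull ℝ A, ψ a = y ∧ φ a = t}
      (sInf {t | ∃ a ∈ convexHull ℝ A, ψ a = y ∧ φ a = t}))
    {x : E} (hx : x ∈ convexHull ℝ (ψ '' A)) :
    lowerConvexEnvelope (ψ '' A) (fun y => sInf {t | ∃ a ∈ A, ψ a = y ∧ φ a = t}) x =
      sInf {t | ∃ a ∈ convexHull ℝ A, ψ a = x ∧ φ a = t} := by
  set G : E → ℝ := fun y => sInf {t | ∃ a ∈ convexHull ℝ A, ψ a = y ∧ φ a = t}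
  refine IsGreatest.csSup_eq ⟨⟨G, ⟨convex_convexHull ℝ _, ?_⟩, ?_, rfl⟩, ?_⟩
  · intro y hy z hz s t hs ht hst
    obtain ⟨a, ha, hay, hag⟩ := (hconv y hy).1
    obtain ⟨b, hb, hbz, hbg⟩ := (hconv z hz).1
    change φ a = G y at hag
    change φ b = G z at hbg
    refine (hconv _ (convex_convexHull ℝ _ hy hz hs ht hst)).2
      ⟨s • a + t • b, convex_convexHull ℝ _ ha hb hs ht hst, ?_, ?_⟩
    · simp [hay, hbz]
    · simp [hag, hbg]
  · intro y hy
    obtain ⟨a, ha, hay, hag⟩ := (hA y hy).1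
    exact (hconv y (subset_convexHull ℝ _ hy)).2 ⟨a, subset_convexHull ℝ _ ha, hay, hag⟩
  · rintro t ⟨g, hg, hle, rfl⟩
    obtain ⟨a, ha, hax, hag⟩ := (hconv x hx).1
    rw [← hag, ← hax]
    exact le_of_convexOn_of_le_of_mem_convexHull A ψ φ hg
      (fun b hb => (hle _ ⟨b, hb, rfl⟩).trans ((hA _ ⟨b, hb, rfl⟩).2 ⟨b, hb, rfl, rfl⟩)) ha

section Fermions

variable {N d : ℕ}

/-- `oneRDM` as a real-linear map. -/
noncomputable def oneRDMₗ (N d : ℕ) [NeZero N] :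
    (FermionSpace N d →ₗ[ℂ] FermionSpace N d) →ₗ[ℝ] Matrix (Fin d) (Fin d) ℂ where
  toFun := oneRDM
  map_add' Γ Δ := by
    ext i j
    simp [oneRDM, partialTrace, tensorMatrix, Finset.sum_add_distrib, mul_add]
  map_smul' c Γ := by
    ext i j
    simp [oneRDM, partialTrace, tensorMatrix, ← Finset.mul_sum, mul_left_comm]

/-- `expectation W` as a real-linear map. -/
noncomputable def expectationₗ (W : FermionSpace N d →ₗ[ℂ] FermionSpace N d) :
    (FermionSpace N d →ₗ[ℂ] FermionSpace N d) →ₗ[ℝ] ℝ where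
  toFun := expectation W
  map_add' Γ Δ := by
    simp [expectation, LinearMap.add_comp]
  map_smul' c Γ := by
    rw [← Complex.coe_smul]
    simp [expectation, LinearMap.smul_comp]

theorem isLeast_searchValues [NeZero N] (W : FermionSpace N d →ₗ[ℂ] FermionSpace N d)
    {n : ℕ} {K : Set (Fin n → ℝ)} (hK : IsCompact K)
    {A : Set (FermionSpace N d →ₗ[ℂ] FermionSpace N d)}
    (hA : A = spectralSumSet (FermionSpace N d) K)
    {γ : Matrix (Fin d) (Fin d) ℂ} (hγ : γ ∈ oneRDM '' A) :
    IsLeast (searchValues W A γ) (sInf (searchValues W A γ)) := by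
  subst hA
  exact isLeast_constrained_spectralSumSet (H := FermionSpace N d)
    (φ := expectation W) (ψ := oneRDM) (expectationₗ W).map_add
    (fun s T => (congrArg _ (LinearMap.real_smul_eq_complex_smul (H := FermionSpace N d) s T).symm).trans
      ((expectationₗ W).map_smul s T))
    (oneRDMₗ N d).map_add
    (fun s T => (congrArg _ (LinearMap.real_smul_eq_complex_smul (H := FermionSpace N d) s T).symm).trans
      ((oneRDMₗ N d).map_smul s T)) hK hγ

end Fermions

theorem theorem12 (N d : ℕ) [NeZero N]
    (W : FermionSpace N d →ₗ[ℂ] FermionSpace N d) (hW : LinearMap.IsSymmetric (𝕜 := ℂ) (E := FermionSpace N d) W)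
    (w : Fin (fermionDim N d) → ℝ) (hw_anti : Antitone w) (hw_nonneg : ∀ j, 0 ≤ w j)
    (hw_sum : ∑ j, w j = 1) :
    -- the minimum that defines the `w`-ensemble functional is attained on its domain
    (∀ γ ∈ oneRDMSet N d w,
      IsLeast (searchValues W (ensembleSet N d w) γ) (ensembleFunctional W w γ)) ∧
    -- the relaxed functional is a constrained search over the convex hull
    (∀ γ ∈ convexHull ℝ (oneRDMSet N d w),
      IsLeast (searchValues W (convexHull ℝ (ensembleSet N d w)) γ) (relaxedFunctional W w γ)) ∧
    convexHull ℝ (ensembleSet N d w) = ⋃ w' ∈ {v | MajorizedBy v w}, ensembleSet N d w' ∧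
    convexHull ℝ (ensembleSet N d w) = {Γ ∈ densityOperators N d | MajorizedBy (specDown Γ) w} ∧
    convexHull ℝ (oneRDMSet N d w) = oneRDM '' convexHull ℝ (ensembleSet N d w) ∧
    convexHull ℝ (oneRDMSet N d w) = ⋃ w' ∈ {v | MajorizedBy v w}, oneRDMSet N d w' := by

  have hens : ∀ γ ∈ oneRDMSet N d w,
      IsLeast (searchValues W (ensembleSet N d w) γ) (ensembleFunctional W w γ) :=
    fun γ hγ => isLeast_searchValues W isCompact_singleton
      (isospectralStates_eq_spectralSumSet (H := FermionSpace N d) rfl hw_anti hw_nonneg hw_sum) hγ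
  have himage : convexHull ℝ (oneRDMSet N d w) = oneRDM '' convexHull ℝ (ensembleSet N d w) :=
    ((oneRDMₗ N d).image_convexHull (ensembleSet N d w)).symm
  have hhull : ∀ γ ∈ convexHull ℝ (oneRDMSet N d w),
      IsLeast (searchValues W (convexHull ℝ (ensembleSet N d w)) γ)
        (sInf (searchValues W (convexHull ℝ (ensembleSet N d w)) γ)) := by
    intro γ hγ
    rw [himage] at hγ
    exact isLeast_searchValues W ((Set.finite_range _).isCompact_convexHull ℝ)
      (convexHull_isospectralStates_eq_spectralSumSet (H := FermionSpace N d) rfl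
        hw_anti hw_nonneg hw_sum) hγ
  have hchar : convexHull ℝ (ensembleSet N d w) =
      {Γ ∈ densityOperators N d | MajorizedBy (specDown Γ) w} :=
    convexHull_isospectralStates (H := FermionSpace N d) rfl hw_anti hw_nonneg hw_sum
  have hunion : convexHull ℝ (ensembleSet N d w) =
      ⋃ w' ∈ {v | MajorizedBy v w}, ensembleSet N d w' := by
    rw [hchar]
    ext Γ
    simp only [Set.mem_iUnion, Set.mem_ofPred_eq, ensembleSet]
    exact ⟨fun h => ⟨_, h.2, h.1, rfl⟩, fun ⟨_, hmaj, h, he⟩ => ⟨h, he ▸ hmaj⟩⟩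
  refine ⟨hens, fun γ hγ => ?_, hunion, hchar, himage, ?_⟩
  · have h := lowerConvexEnvelope_eq_sInf (ensembleSet N d w) (oneRDMₗ N d) (expectationₗ W)
      hens hhull hγ
    have h' : relaxedFunctional W w γ =
        sInf (searchValues W (convexHull ℝ (ensembleSet N d w)) γ) := h
    rw [h']
    exact hhull γ hγ
  · rw [himage, hunion]
    simp only [Set.image_iUnion]
    rfl
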